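/- Let $\log$ denote the logarithm to base $2$, and let $D,B>0$. Setting. Let $d\ge 1$ and $\mathcal X=\{x\in\mathbb R^d:\|x\|_2\le D/2\}$. A mean square bounded oracle for a convex function $f:\mathcal X\to\mathbb R$ answers each query $x\in\mathcal X$ with a random vector $\hat g(x)\in\mathbb R^d$ (independent of the past given $x$) such that $\mathbb E[\hat g(x)\mid x]\in\partial f(x)$ and $\mathbb E[\|\hat g(x)\|_2^2\mid x]\le B^2$; let $\mathcal O$ be the set of all such pairs $(f,O)$. An $r$-bit quantizer on $\mathbb R^k$ is a composition $Q=Q^{\mathtt d}\circ Q^{\mathtt e}$ of randomized maps $Q^{\mathtt e}:\mathbb R^k\to\{0,1\}^r$ and $Q^{\mathtt d}:\{0,1\}^r\to\mathbb R^k$, which may share randomness; $QO$ is the oracle that answers a query $x$ with $Q(\hat g(x))$, where $Q$ uses fresh randomness at each query. An optimization protocol $\pi$ with at most $T$ iterations is a randomized adaptive algorithm that makes at most $T$ queries in $\mathcal X$ to $QO$ and then outputs a point $x^*(\pi^{QO})\in\mathcal X$; its error is $\mathcal E(f,\pi^{QO})=\mathbb E[f(x^*(\pi^{QO}))]-\min_{x\in\mathcal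 X}f(x)$. Structural assumptions. Let $Q$ be an $r$-bit quantizer on $\mathbb R^d$ of gain-shape form $Q(y)=Q_g(\|y\|_2)\cdot Q_s(y/\|y\|_2)$, where $Q_g$ is a quantizer on $\mathbb R$ and $Q_s$ is a quantizer on $\mathbb R^d$ (with $y/\|y\|_2:=e_1$ for $y=0$), and suppose that: 1. (Independent gain-shape quantization) for every $y\in\mathbb R^d$, the outputs $Q_g(\|y\|_2)$ and $Q_s(y/\|y\|_2)$ are independent; 2. (Bounded dynamic range) there are $M>0$ and a distribution $P_\emptyset$ such that $Q(y)$ has distribution $P_\emptyset$ whenever $\|y\|_2>M$; 3. (Uniformity) there is $m\in[M/2^r,M]$, with the same $M$, such that for every $t\in[0,m]$ the support of $Q_g(t)$ is contained in $\{0,m\}$, and, for all $0\le t_1\le t_2\le m$ with $P(Q_g(t_1)=m)>0$, $$\frac{P(Q_g(t_2)=m)}{P(Q_g(t_1)=m)}\le\frac{t_2}{t_1}$$ (with right-hand side $+\infty$ if $t_1=0$). Theorem. There is a universal constant $c>0$ such that the following holds for all $d\ge1$, $r\ge 0$, $D,B>0$, all integers $T>36$ and every gain-shape quantizer $Q$ of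 precision $r$ satisfying Assumptions 1–3. If there is an optimization protocol $\pi$ with at most $T$ iterations such that $$\sup_{(f,O)\in\mathcal O}\mathcal E(f,\pi^{QO})\le\frac{3DB}{\sqrt T},$$ then $$r\ge c\,(d+\log T).$$ -/

import Mathlib

open MeasureTheory ProbabilityTheory

/-- An `r`-bit quantizer on `X`: a randomized encoder into `{0,1}^r` followed by a randomized
decoder. All the randomness (private or shared by encoder and decoder) is carried by the
seed `s : S`; for a fixed seed, encoder and decoder are deterministic maps. -/
structure Quantizer (S X : Type*) [MeasurableSpace S] [MeasurableSpace X] (r : ℕ) where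
  enc : S → X → (Fin r → Bool)
  dec : S → (Fin r → Bool) → X
  measurable_enc : Measurable (Function.uncurry enc)
  measurable_dec : Measurable (Function.uncurry dec)

namespace Quantizer

variable {S X : Type*} [MeasurableSpace S] [MeasurableSpace X] {r : ℕ}

/-- The output `Q(x)` of the quantizer as a random variable, i.e. a function of the seed. -/
def apply (Q : Quantizer S X r) (s : S) (x : X) : X := Q.dec s (Q.enc s x)

theorem measurable_apply (Q : Quantizer S X r) : Measurable (Function.uncurry Q.apply) :=
  Q.measurable_dec.comp (measurable_fst.prodMk Q.measurable_enc)

theorem measurable_apply_left (Q : Quantizer S X r) (x : X) :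
    Measurable fun s => Q.apply s x :=
  Q.measurable_apply.comp (measurable_id.prodMk measurable_const)

/-- The channel of the quantizer when its seed is drawn from `μ`: it sends `x` to the
distribution of `Q(x)`. -/
noncomputable def kernel (Q : Quantizer S X r) (μ : Measure S) [SFinite μ] : Kernel X X where
  toFun x := μ.map fun s => Q.apply s x
  measurable' := by
    refine Measure.measurable_of_measurable_coe _ fun A hA => ?_
    have h : ∀ x, (μ.map fun s => Q.apply s x) A = μ {s | Q.apply s x ∈ A} := fun x =>
      Measure.map_apply (Q.measurable_apply_left x) hA
    simp_rw [h]
    exact measurable_measure_prodMk_right (Q.measurable_apply hA)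

instance isMarkovKernel_kernel (Q : Quantizer S X r) (μ : Measure S) [IsProbabilityMeasure μ] :
    IsMarkovKernel (Q.kernel μ) :=
  ⟨fun x => Measure.isProbabilityMeasure_map (Q.measurable_apply_left x).aemeasurable⟩

end Quantizer

/-- The shape `y / ‖y‖` of a vector, with the convention that the shape of `0` is the first
standard basis vector. -/
noncomputable def shape {d : ℕ} [NeZero d] (y : EuclideanSpace ℝ (Fin d)) :
    EuclideanSpace ℝ (Fin d) :=
  open Classical in if y = 0 then EuclideanSpace.single 0 1 else ‖y‖⁻¹ • y

/-- `Q` is the gain-shape quantizer `Q(y) = Q_g(‖y‖) Q_s(y/‖y‖)`. -/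
def IsGainShape {S : Type*} [MeasurableSpace S] (μ : Measure S) {d r rg rs : ℕ} [NeZero d]
    (Q : Quantizer S (EuclideanSpace ℝ (Fin d)) r)
    (Qg : Quantizer S ℝ rg) (Qs : Quantizer S (EuclideanSpace ℝ (Fin d)) rs) : Prop :=
  ∀ y, ∀ᵐ s ∂μ, Q.apply s y = Qg.apply s ‖y‖ • Qs.apply s (shape y)

/-- Independent gain-shape quantization: for each given `y`, the outputs of the gain and of
the shape quantizer are independent. -/
def IndependentGainShape {S : Type*} [MeasurableSpace S] (μ : Measure S) {d rg rs : ℕ} [NeZero d]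
    (Qg : Quantizer S ℝ rg) (Qs : Quantizer S (EuclideanSpace ℝ (Fin d)) rs) : Prop :=
  ∀ y : EuclideanSpace ℝ (Fin d),
    IndepFun (fun s => Qg.apply s ‖y‖) (fun s => Qs.apply s (shape y)) μ

/-- Bounded dynamic range `M`: all inputs of norm larger than `M` have the same output
distribution. -/
def BoundedDynamicRange {S : Type*} [MeasurableSpace S] (μ : Measure S) [SFinite μ] {d r : ℕ}
    (Q : Quantizer S (EuclideanSpace ℝ (Fin d)) r) (M : ℝ) : Prop :=
  ∃ P₀ : Measure (EuclideanSpace ℝ (Fin d)), ∀ y, M < ‖y‖ → Q.kernel μ y = P₀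

/-- Uniformity of the gain quantizer with innermost level `m`: on `[0, m]` it only outputs `0`
and `m`, and `P(Q_g(t₂) = m) / P(Q_g(t₁) = m) ≤ t₂ / t₁` for `0 ≤ t₁ ≤ t₂ ≤ m` whenever
`P(Q_g(t₁) = m) > 0` (the right-hand side is `+∞` for `t₁ = 0`). -/
structure UniformGain {S : Type*} [MeasurableSpace S] (μ : Measure S) {rg : ℕ}
    (Qg : Quantizer S ℝ rg) (m : ℝ) : Prop where
  support_subset : ∀ t ∈ Set.Icc 0 m, ∀ᵐ s ∂μ, Qg.apply s t ∈ ({0, m} : Set ℝ)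
  ratio_le : ∀ t₁ t₂ : ℝ, 0 ≤ t₁ → t₁ ≤ t₂ → t₂ ≤ m → 0 < μ.real {s | Qg.apply s t₁ = m} →
    t₁ * μ.real {s | Qg.apply s t₂ = m} ≤ t₂ * μ.real {s | Qg.apply s t₁ = m}

section Optimization

variable {E : Type*} [NormedAddCommGroup E] [InnerProductSpace ℝ E]

/-- The subgradients at `x` of a function `f` with domain `X`. -/
def subdifferentialOn (X : Set E) (f : E → ℝ) (x : E) : Set E :=
  {g | ∀ y ∈ X, f x + inner ℝ g (y - x) ≤ f y}

/-- `(f, O)` is a convex function on `X` together with a mean square bounded first order oracle: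
at the query `x`, the oracle answers with a random vector of law `O x`. Only the values of
`f` and `O` on `X` matter. -/
structure IsMeanSquareBoundedOracle [MeasurableSpace E] (X : Set E) (B : ℝ)
    (f : E → ℝ) (O : Kernel E E) : Prop where
  convexOn : ConvexOn ℝ X f
  unbiased : ∀ x ∈ X, ∫ g, g ∂(O x) ∈ subdifferentialOn X f x
  secondMoment_le : ∀ x ∈ X, ∫⁻ g, ‖g‖ₑ ^ 2 ∂(O x) ≤ ENNReal.ofReal (B ^ 2)

end Optimization

/-- A randomized adaptive optimization protocol on the domain `X` with `n` iterations. Its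
internal randomness is the seed `w : W`. In iteration `t` (counted from `0`) it queries the point
`query t w z`, where `z` are the `t` previous answers; after `n` answers it returns `output w z`.
Only the queries with `t < n` are made. -/
structure Protocol (W : Type*) [MeasurableSpace W] {E : Type*} [MeasurableSpace E]
    (X : Set E) (n : ℕ) where
  query : (t : ℕ) → W → (Fin t → E) → E
  measurable_query : ∀ t, Measurable (Function.uncurry (query t))
  query_mem : ∀ t w z, query t w z ∈ X
  output : W → (Fin n → E) → E
  measurable_output : Measurable (Function.uncurry output)
  output_mem : ∀ w z, output w z ∈ X

namespace Protocol

variable {W E : Type*} [MeasurableSpace W] [MeasurableSpace E] {X : Set E} {n : ℕ}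

theorem measurable_append (t : ℕ) :
    Measurable fun p : (W × (Fin t → E)) × E =>
      ((p.1.1, Fin.snoc (α := fun _ => E) p.1.2 p.2) : W × (Fin (t + 1) → E)) := by
  refine measurable_fst.fst.prodMk (measurable_pi_lambda _ fun i => ?_)
  refine Fin.lastCases ?_ (fun j => ?_) i
  · simpa using measurable_snd
  · have h : Measurable fun p : (W × (Fin t → E)) × E => p.1.2 j :=
      (measurable_pi_apply j).comp measurable_fst.snd
    simpa using h

/-- The joint law of the internal seed, of law `ν`, and the first `t` answers, when a query `x` is
answered by a sample from `K x` (independent of the past given `x`). -/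
noncomputable def transcript (π : Protocol W X n) (ν : Measure W) (K : Kernel E E) :
    (t : ℕ) → Measure (W × (Fin t → E))
  | 0 => ν.map fun w => (w, Fin.elim0)
  | t + 1 => ((π.transcript ν K t) ⊗ₘ
      (K.comap (Function.uncurry (π.query t)) (π.measurable_query t))).map
        fun p => (p.1.1, Fin.snoc (α := fun _ => E) p.1.2 p.2)

instance isProbabilityMeasure_transcript (π : Protocol W X n) (ν : Measure W)
    [IsProbabilityMeasure ν] (K : Kernel E E) [IsMarkovKernel K] (t : ℕ) :
    IsProbabilityMeasure (π.transcript ν K t) := by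
  induction t with
  | zero =>
    exact Measure.isProbabilityMeasure_map (measurable_id.prodMk measurable_const).aemeasurable
  | succ t ih => exact Measure.isProbabilityMeasure_map (measurable_append t).aemeasurable

/-- The expected optimization error `E[f(x*) - min_X f]` of the protocol when its queries are
answered by `K`. -/
noncomputable def error (π : Protocol W X n) (ν : Measure W) (K : Kernel E E) (f : E → ℝ) : ℝ :=
  (∫ p, f (π.output p.1 p.2) ∂(π.transcript ν K n)) - sInf (f '' X)

end Protocol

/-! Linear objectives `⟨a, x⟩` suffice. Their gradient is constant, so the oracle may answer with
i.i.d. copies of any finitely supported vector of mean `a` and second moment at most `B²`.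
Adaptivity is then useless, and a protocol becomes an estimator `G` in the unit ball with `E⟨a, G⟩ +
‖a‖ ≤ 6B/√T` (`exists_estimator`). Each bound on `r` comes from answer laws that the channel hides
too well for such an estimator.

Logarithmic bound: vectors `±y` of norm above `M` are indistinguishable; sent with probability
`B²/‖y‖²`, they force `M ≥ B√T/6` (`sq_div_norm_le`). Next, for large `T` the level `m` must lie
below `2000 B`. Otherwise answers of norms `B` and `2000 B` along `±u` both arrive as an erasure or
as a noisy sign, and the law of that sign does not depend on the norm (`kernel_eq_mixture`). If norm
`B` is revealed often, it can mask rare answers of norm `2000 B` in the opposite direction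
(`masking`); if it is revealed rarely, a slight bias of `±Bu` is undetectable (`two_point`). Then
`M/2^r ≤ m` gives `T ≤ 2^(32 r)`.

Dimension bound: a random sign vector is sent with probability of order `1/T` at norm of order
`B√T`. Only boundedly many answers are informative on average, each carrying `r` bits, while
correlating with a random sign vector in dimension `d` needs of order `d` bits (`erasure`). -/

open scoped NNReal ENNReal

/-! ### Finite products of mixtures -/

section PiMeasure

variable {n : ℕ} {E : Type*} [MeasurableSpace E]

/-- A product of finite mixtures is the mixture of the products. -/
theorem pi_sum_smul {ι : Type*} [Fintype ι] (c : ι → ℝ≥0) (κ : ι → Measure E)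
    [∀ i, IsFiniteMeasure (κ i)] :
    Measure.pi (fun _ : Fin n => ∑ i, c i • κ i)
      = ∑ σ : Fin n → ι, (∏ j, c (σ j)) • Measure.pi fun j => κ (σ j) := by
  classical
  have : ∀ i, IsFiniteMeasure (c i • κ i) := fun i => inferInstance
  refine Measure.pi_eq fun s hs => ?_
  simp only [Measure.coe_finsetSum, Finset.sum_apply, Measure.coe_nnreal_smul_apply,
    Measure.pi_pi]
  rw [Finset.prod_univ_sum]
  simp only [Fintype.piFinset_univ, Finset.prod_mul_distrib,
    ENNReal.ofNNReal_finsetProd]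

/-- The product outer measure is the largest one bounded on boxes by the product of the side masses,
so a comparison on boxes suffices. -/
theorem pi_le_pi {κ κ' : Fin n → Measure E} [∀ i, SigmaFinite (κ i)] [∀ i, SigmaFinite (κ' i)]
    (h : ∀ i, κ i ≤ κ' i) : Measure.pi κ ≤ Measure.pi κ' := by
  refine Measure.le_iff.2 fun s hs => ?_
  have key : (Measure.pi κ).toOuterMeasure
      ≤ OuterMeasure.pi fun i => (κ' i).toOuterMeasure := by
    refine OuterMeasure.le_pi.2 fun t _ => ?_
    change Measure.pi κ (Set.pi Set.univ t) ≤ _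
    rw [Measure.pi_pi]
    exact Finset.prod_le_prod' fun i _ => h i _
  refine (key s).trans_eq ?_
  rw [Measure.pi, toMeasure_apply _ _ hs]

end PiMeasure

/-! ### Protocols whose answers do not depend on the queries -/

namespace Protocol

variable {W E : Type*} [MeasurableSpace W] [MeasurableSpace E] {X : Set E} {n : ℕ}

/-- A channel that ignores the query makes adaptivity void: the answers are i.i.d. and independent
of the seed. -/
theorem transcript_const (π : Protocol W X n) (ν : Measure W) [IsProbabilityMeasure ν]
    (κ : Measure E) [IsProbabilityMeasure κ] (t : ℕ) :
    π.transcript ν (Kernel.const E κ) t = ν.prod (Measure.pi fun _ : Fin t => κ) := by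
  induction t with
  | zero =>
    rw [transcript, Measure.pi_of_empty _ Fin.elim0, Measure.prod_dirac]
  | succ t ih =>
    rw [transcript, ih]
    have hc : (Kernel.const E κ).comap (Function.uncurry (π.query t)) (π.measurable_query t)
        = Kernel.const (W × (Fin t → E)) κ := rfl
    rw [hc, Measure.compProd_const]
    have h1 := (measurePreserving_piFinSuccAbove (fun _ : Fin (t + 1) => κ) (Fin.last t)).symm
    have h2 := h1.comp (Measure.measurePreserving_swap
      (μ := Measure.pi fun _ : Fin t => κ) (ν := κ))
    have h3 := ((MeasurePreserving.id ν).prod h2).comp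
      (measurePreserving_prodAssoc ν (Measure.pi fun _ : Fin t => κ) κ)
    rw [← h3.map_eq]
    congr 1
    funext p
    simp [MeasurableEquiv.piFinSuccAbove, Fin.insertNthEquiv]
    rfl

end Protocol

/-! ### Linear functions on a ball -/

section Ball

variable {E : Type*} [NormedAddCommGroup E] [InnerProductSpace ℝ E]

theorem sInf_inner_image_closedBall (a : E) {R : ℝ} (hR : 0 ≤ R) :
    sInf ((fun x => inner ℝ a x) '' Metric.closedBall (0 : E) R) = -(‖a‖ * R) := by
  refine IsLeast.csInf_eq ⟨?_, ?_⟩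
  · rcases eq_or_ne a 0 with rfl | ha
    · exact ⟨0, by simpa using hR, by simp⟩
    · have ha' : ‖a‖ ≠ 0 := norm_ne_zero_iff.2 ha
      refine ⟨-(R / ‖a‖) • a, ?_, ?_⟩
      · rw [mem_closedBall_zero_iff, norm_smul, norm_neg, norm_div, norm_norm,
          Real.norm_of_nonneg hR, div_mul_cancel₀ _ ha']
      · simp only [inner_smul_right, real_inner_self_eq_norm_sq]
        field_simp
  · rintro _ ⟨x, hx, rfl⟩
    have h1 := abs_real_inner_le_norm a x
    have h2 : ‖x‖ ≤ R := mem_closedBall_zero_iff.1 hx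
    have := mul_le_mul_of_nonneg_left h2 (norm_nonneg a)
    linarith [neg_abs_le (inner ℝ a x)]

end Ball

/-! ### Reduction from optimization to estimation of a descent direction. -/

theorem bind_sum_smul_dirac {E : Type*} [MeasurableSpace E] {ι : Type*} [Fintype ι]
    (c : ι → ℝ≥0) (y : ι → E) (κ : Kernel E E) :
    (∑ i, c i • Measure.dirac (y i)).bind κ = ∑ i, c i • κ (y i) := by
  ext s hs
  rw [Measure.bind_apply hs κ.aemeasurable, lintegral_finsetSum_measure]
  simp only [Measure.coe_finsetSum, Finset.sum_apply, Measure.coe_nnreal_smul_apply]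
  refine Finset.sum_congr rfl fun i _ => ?_
  rw [lintegral_smul_measure, lintegral_dirac' _ (κ.measurable_coe hs)]
  rfl

/-- The estimator `G`, applied to `n` answers of the channel `κ` to independent copies of a
finitely supported random vector of second moment at most `B²` and mean `a`, points in the
direction `-a` up to an error `ε`. -/
structure IsDescentEstimator {E : Type*} [NormedAddCommGroup E] [InnerProductSpace ℝ E]
    [MeasurableSpace E] (κ : Kernel E E) {n : ℕ} (G : (Fin n → E) → E)
    (B ε : ℝ) : Prop where
  stronglyMeasurable : StronglyMeasurable G
  norm_le_one : ∀ z, ‖G z‖ ≤ 1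
  le_of_mixture : ∀ (ι : Type) [Fintype ι] (c : ι → ℝ≥0) (y : ι → E),
    ∑ i, c i = 1 → ∑ i, (c i : ℝ) * ‖y i‖ ^ 2 ≤ B ^ 2 →
      (∫ z, inner ℝ (∑ i, c i • y i) (G z) ∂(Measure.pi fun _ => ∑ i, c i • κ (y i)))
        + ‖∑ i, c i • y i‖ ≤ ε

/-- A protocol of error at most `D / 2 * ε` for linear functions on the ball of diameter `D` gives
an estimator of the direction of descent from `n` independent answers. -/
theorem exists_estimator {d n : ℕ} {B D ε : ℝ} (hD : 0 < D)
    (κ : Kernel (EuclideanSpace ℝ (Fin d)) (EuclideanSpace ℝ (Fin d))) [IsMarkovKernel κ]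
    {W : Type*} [MeasurableSpace W] (ν : Measure W) [IsProbabilityMeasure ν]
    (π : Protocol W (Metric.closedBall (0 : EuclideanSpace ℝ (Fin d)) (D / 2)) n)
    (hπ : ∀ (f : EuclideanSpace ℝ (Fin d) → ℝ)
      (O : Kernel (EuclideanSpace ℝ (Fin d)) (EuclideanSpace ℝ (Fin d))) [IsMarkovKernel O],
      IsMeanSquareBoundedOracle (Metric.closedBall 0 (D / 2)) B f O →
        π.error ν (κ ∘ₖ O) f ≤ D / 2 * ε) :
    ∃ G : (Fin n → EuclideanSpace ℝ (Fin d)) → EuclideanSpace ℝ (Fin d),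
      IsDescentEstimator κ G B ε := by
  set E := EuclideanSpace ℝ (Fin d)
  have hmeas : StronglyMeasurable (Function.uncurry fun (z : Fin n → E) (w : W) =>
      (2 / D) • π.output w z) := by
    have := (π.measurable_output.comp measurable_swap).const_smul (2 / D)
    exact this.stronglyMeasurable
  have hbd : ∀ w z, ‖(2 / D) • π.output w z‖ ≤ 1 := fun w z => by
    have h := mem_closedBall_zero_iff.1 (π.output_mem w z)
    rw [norm_smul, Real.norm_of_nonneg (by positivity)]
    calc 2 / D * ‖π.output w z‖ ≤ 2 / D * (D / 2) := by gcongr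
      _ = 1 := by field_simp
  -- The output is rescaled to the unit ball and averaged over the seed; linearity of the objective
  -- makes the averaging free.
  refine ⟨fun z => ∫ w, (2 / D) • π.output w z ∂ν, hmeas.integral_prod_right, fun z => ?_, ?_⟩
  · exact (norm_integral_le_of_norm_le_const (C := 1) (Filter.Eventually.of_forall fun w => hbd w z)).trans
      (by simp)
  intro ι _ c y hc hy
  set a : E := ∑ i, c i • y i with ha
  set ρ : Measure E := ∑ i, c i • Measure.dirac (y i) with hρ
  set q : Measure E := ∑ i, c i • κ (y i) with hq
  have hρp : IsProbabilityMeasure ρ := ⟨by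
    simp only [hρ, Measure.coe_finsetSum, Finset.sum_apply, Measure.coe_nnreal_smul_apply,
      measure_univ, mul_one]
    exact_mod_cast hc⟩
  have hqp : IsProbabilityMeasure q := ⟨by
    simp only [hq, Measure.coe_finsetSum, Finset.sum_apply, Measure.coe_nnreal_smul_apply,
      measure_univ, mul_one]
    exact_mod_cast hc⟩
  have hO : IsMeanSquareBoundedOracle (Metric.closedBall 0 (D / 2)) B (fun x => inner ℝ a x)
      (Kernel.const E ρ) := by
    refine ⟨⟨convex_closedBall _ _, fun x _ y _ s t _ _ _ => ?_⟩, fun x _ => ?_, fun x _ => ?_⟩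
    · simp [inner_add_right, inner_smul_right]
    · have : ∫ g, g ∂(Kernel.const E ρ x) = a := by
        rw [Kernel.const_apply, hρ, integral_finsetSum_measure]
        · simp [integral_smul_nnreal_measure, ha]
        · intro i _
          exact (integrable_dirac (by simp)).smul_measure_nnreal
      rw [this]
      intro z _
      simp [inner_sub_right]
    · rw [Kernel.const_apply, hρ, lintegral_finsetSum_measure]
      simp only [lintegral_smul_measure, lintegral_dirac]
      refine le_trans (le_of_eq ?_) (ENNReal.ofReal_le_ofReal hy)
      rw [ENNReal.ofReal_sum_of_nonneg (fun i _ => by positivity)]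
      refine Finset.sum_congr rfl fun i _ => ?_
      rw [ENNReal.ofReal_mul (by positivity), ENNReal.ofReal_coe_nnreal,
        ENNReal.ofReal_pow (norm_nonneg _), ofReal_norm]
      rfl
  have hmain := hπ _ _ hO
  have hcomp : κ ∘ₖ Kernel.const E ρ = Kernel.const E q := by
    ext1 x
    rw [Kernel.comp_apply, Kernel.const_apply, Kernel.const_apply, hρ,
      bind_sum_smul_dirac]
  rw [hcomp, Protocol.error, Protocol.transcript_const,
    sInf_inner_image_closedBall a (by positivity)] at hmain
  have hint : Integrable (fun p : W × (Fin n → E) => (2 / D) • π.output p.1 p.2)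
      (ν.prod (Measure.pi fun _ => q)) :=
    Integrable.of_bound (π.measurable_output.const_smul (2 / D)).aestronglyMeasurable 1
      (Filter.Eventually.of_forall fun p => hbd p.1 p.2)
  have hG : ∫ z, inner ℝ a (∫ w, (2 / D) • π.output w z ∂ν) ∂(Measure.pi fun _ => q)
      = 2 / D * ∫ p : W × (Fin n → E), inner ℝ a (π.output p.1 p.2)
          ∂(ν.prod (Measure.pi fun _ => q)) := by
    rw [integral_inner hint.integral_prod_right, ← integral_prod_symm _ hint, ← integral_inner hint,
      ← integral_const_mul]
    simp only [inner_smul_right]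
  rw [hG]
  have := mul_le_mul_of_nonneg_left hmain (show (0 : ℝ) ≤ 2 / D by positivity)
  have e1 : 2 / D * (D / 2 * ε) = ε := by field_simp
  have e2 : 2 / D * (‖a‖ * (D / 2)) = ‖a‖ := by field_simp
  rw [e1, sub_neg_eq_add, mul_add, e2] at this
  exact this

/-! ### Indistinguishability of product mixtures. -/

theorem integral_pi_sum_smul {n : ℕ} {E : Type*} [MeasurableSpace E] {ι : Type*} [Fintype ι]
    (c : ι → ℝ≥0) (κ : ι → Measure E) [∀ i, IsFiniteMeasure (κ i)] {f : (Fin n → E) → ℝ}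
    (hf : StronglyMeasurable f) {C : ℝ} (hC : ∀ z, |f z| ≤ C) :
    ∫ z, f z ∂(Measure.pi fun _ => ∑ i, c i • κ i)
      = ∑ σ : Fin n → ι, (∏ j, (c (σ j) : ℝ)) * ∫ z, f z ∂(Measure.pi fun j => κ (σ j)) := by
  have hi : ∀ σ : Fin n → ι, Integrable f (Measure.pi fun j => κ (σ j)) := fun σ =>
    Integrable.of_bound hf.aestronglyMeasurable C (Filter.Eventually.of_forall hC)
  rw [pi_sum_smul, integral_finsetSum_measure fun σ _ => (hi σ).smul_measure_nnreal]
  refine Finset.sum_congr rfl fun σ _ => ?_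
  rw [integral_smul_nnreal_measure, NNReal.smul_def, NNReal.coe_prod, smul_eq_mul]

theorem sum_pi_prod {n : ℕ} {ι : Type*} [Fintype ι] (f : ι → ℝ) :
    ∑ σ : Fin n → ι, ∏ j, f (σ j) = (∑ i, f i) ^ n := by
  classical
  rw [← Fin.prod_const, Finset.prod_univ_sum, Fintype.piFinset_univ]

/-- The second moment method for product distributions on a finite alphabet. -/
theorem sq_sum_prod_sub_le {n : ℕ} {ι : Type*} [Fintype ι] {c h : ι → ℝ} {s : ℝ}
    (hc : ∀ i, 0 ≤ c i) (h0 : ∑ i, c i = 1) (h1 : ∑ i, c i * h i = 0)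
    (h2 : ∑ i, c i * h i ^ 2 = s) {g : (Fin n → ι) → ℝ} (hg : ∀ σ, |g σ| ≤ 1) :
    (∑ σ, (∏ j, c (σ j) * (1 + h (σ j))) * g σ - ∑ σ, (∏ j, c (σ j)) * g σ) ^ 2
      ≤ (1 + s) ^ n - 1 := by
  have hc' : ∀ σ : Fin n → ι, 0 ≤ ∏ j, c (σ j) := fun σ => Finset.prod_nonneg fun j _ => hc _
  have e1 : ∑ i, c i * (1 + h i) = 1 := by
    simp only [mul_add, mul_one, Finset.sum_add_distrib, h0, h1, add_zero]
  have e2 : ∑ i, c i * (1 + h i) ^ 2 = 1 + s := by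
    calc ∑ i, c i * (1 + h i) ^ 2 = ∑ i, (c i + 2 * (c i * h i) + c i * h i ^ 2) :=
          Finset.sum_congr rfl fun i _ => by ring
      _ = 1 + s := by
          rw [Finset.sum_add_distrib, Finset.sum_add_distrib, ← Finset.mul_sum, h0, h1, h2]; ring
  -- The χ² distance of the tilted product from the base product, which tensorizes; Cauchy–Schwarz
  -- then bounds the change in the mean of `g`.
  have e3 : ∑ σ : Fin n → ι, (∏ j, c (σ j)) * (∏ j, (1 + h (σ j)) - 1) ^ 2
      = (1 + s) ^ n - 1 := by
    calc _ = ∑ σ : Fin n → ι, (∏ j, c (σ j) * (1 + h (σ j)) ^ 2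
            - 2 * ∏ j, c (σ j) * (1 + h (σ j)) + ∏ j, c (σ j)) :=
          Finset.sum_congr rfl fun σ _ => by
            simp only [Finset.prod_mul_distrib, Finset.prod_pow]; ring
      _ = (1 + s) ^ n - 1 := by
          rw [Finset.sum_add_distrib, Finset.sum_sub_distrib, ← Finset.mul_sum, sum_pi_prod c,
            sum_pi_prod fun i => c i * (1 + h i) ^ 2, sum_pi_prod fun i => c i * (1 + h i),
            e1, e2, h0]
          simp only [one_pow]; ring
  have e4 : ∑ σ : Fin n → ι, (∏ j, c (σ j)) * g σ ^ 2 ≤ 1 := by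
    calc _ ≤ ∑ σ : Fin n → ι, (∏ j, c (σ j)) * 1 := by
          refine Finset.sum_le_sum fun σ _ => mul_le_mul_of_nonneg_left ?_ (hc' σ)
          exact (sq_le_one_iff_abs_le_one _).2 (hg σ)
      _ = 1 := by simp only [mul_one]; rw [sum_pi_prod, h0, one_pow]
  rw [← Finset.sum_sub_distrib]
  have key := Finset.sum_sq_le_sum_mul_sum_of_sq_le_mul Finset.univ
    (r := fun σ : Fin n → ι => (∏ j, c (σ j) * (1 + h (σ j))) * g σ - (∏ j, c (σ j)) * g σ)
    (f := fun σ => (∏ j, c (σ j)) * (∏ j, (1 + h (σ j)) - 1) ^ 2)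
    (g := fun σ => (∏ j, c (σ j)) * g σ ^ 2)
    (fun σ _ => mul_nonneg (hc' σ) (sq_nonneg _)) (fun σ _ => mul_nonneg (hc' σ) (sq_nonneg _))
    (fun σ _ => by simp only [Finset.prod_mul_distrib]; exact le_of_eq (by ring))
  rw [e3] at key
  refine key.trans ?_
  have hnn : 0 ≤ (1 + s) ^ n - 1 := by
    rw [← e3]; exact Finset.sum_nonneg fun σ _ => mul_nonneg (hc' σ) (sq_nonneg _)
  exact mul_le_of_le_one_right hnn e4

section Estimator

variable {E : Type*} [NormedAddCommGroup E] [InnerProductSpace ℝ E] [MeasurableSpace E]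

namespace IsDescentEstimator

variable {κ : Kernel E E} {n : ℕ} {G : (Fin n → E) → E} {B ε : ℝ}

theorem abs_inner_le (hG : IsDescentEstimator κ G B ε) (x : E) (z : Fin n → E) :
    |inner ℝ x (G z)| ≤ ‖x‖ :=
  (abs_real_inner_le_norm _ _).trans
    (mul_le_of_le_one_right (norm_nonneg _) (hG.norm_le_one z))

theorem stronglyMeasurable_inner (hG : IsDescentEstimator κ G B ε) (x : E) :
    StronglyMeasurable fun z => (inner ℝ x (G z) : ℝ) :=
  (continuous_const.inner continuous_id).comp_stronglyMeasurable hG.stronglyMeasurable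

/-- If the channel cannot tell a random vector from its reflection, then its mean is small. -/
theorem norm_le_of_indistinguishable (hG : IsDescentEstimator κ G B ε) {ι : Type} [Fintype ι]
    (c : ι → ℝ≥0) (y : ι → E) (h1 : ∑ i, c i = 1) (h2 : ∑ i, (c i : ℝ) * ‖y i‖ ^ 2 ≤ B ^ 2)
    (h : ∑ i, c i • κ (-y i) = ∑ i, c i • κ (y i)) : ‖∑ i, c i • y i‖ ≤ ε := by
  -- The law and its reflection have opposite means but equal images, so the inner product terms
  -- cancel in the sum of the two guarantees.
  have e1 := hG.le_of_mixture ι c y h1 h2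
  have e2 := hG.le_of_mixture ι c (fun i => -y i) h1 (by simpa using h2)
  simp only [smul_neg, Finset.sum_neg_distrib, norm_neg, inner_neg_left, integral_neg, h] at e2
  linarith

/-- A channel that reveals the direction of `±y` only with probability `w` gives no estimator
of accuracy `‖y‖ δ (1 - η)` as long as `n δ² w` is small. -/
theorem two_point (hG : IsDescentEstimator κ G B ε) {y : E} (hy : 0 < ‖y‖) (hyB : ‖y‖ ≤ B)
    {w w' p q : ℝ≥0} (hw : w' + w = 1) (hpq : p + q = 1) (hle : q ≤ p) {P₀ P₁ P₂ : Measure E}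
    [IsProbabilityMeasure P₀] [IsProbabilityMeasure P₁] [IsProbabilityMeasure P₂]
    (h₁ : κ y = w' • P₀ + w • P₁) (h₂ : κ (-y) = w' • P₀ + w • P₂) {η : ℝ} (hη : 0 ≤ η)
    (hn : (1 + ((p : ℝ) - q) ^ 2 * w) ^ n ≤ 1 + η ^ 2) :
    ‖y‖ * ((p : ℝ) - q) * (1 - η) ≤ ε := by
  set δ : ℝ := (p : ℝ) - q with hδ
  have hδ0 : 0 ≤ δ := sub_nonneg.2 (by exact_mod_cast hle)
  have hwR : (w' : ℝ) + w = 1 := by exact_mod_cast hw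
  have hpqR : (p : ℝ) + q = 1 := by exact_mod_cast hpq
  set L : Fin 3 → Measure E := ![P₀, P₁, P₂] with hL
  have hLf : ∀ i, IsProbabilityMeasure (L i) := by
    intro i; fin_cases i <;> simp only [hL] <;> simpa
  have hB : ‖y‖ ^ 2 ≤ B ^ 2 := by gcongr
  -- The image of a biased `±y` is a mixture over three labels: erased, plus, minus. Only the label
  -- weights depend on the bias.
  have main : ∀ p' q' : ℝ≥0, p' + q' = 1 →
      ((p' : ℝ) - q') * ‖y‖ * (∑ σ : Fin n → Fin 3, (∏ j, ((![w', p' * w, q' * w] (σ j) : ℝ≥0) : ℝ))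
        * ∫ z, inner ℝ (‖y‖⁻¹ • y) (G z) ∂(Measure.pi fun j => L (σ j)))
        + |(p' : ℝ) - q'| * ‖y‖ ≤ ε := by
    intro p' q' h'
    have hR : (p' : ℝ) + q' = 1 := by exact_mod_cast h'
    have := hG.le_of_mixture (Fin 2) ![p', q'] ![y, -y] (by simpa using h') (by
      simp [← add_mul, hR, hB])
    have e1 : ∑ i, ![p', q'] i • ![y, -y] i = ((p' : ℝ) - q') • y := by
      simp only [Fin.sum_univ_two, Matrix.cons_val_zero, Matrix.cons_val_one, NNReal.smul_def]
      module
    have e2 : ∑ i, ![p', q'] i • κ (![y, -y] i)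
        = ∑ i, (![w', p' * w, q' * w] i) • L i := by
      simp only [Fin.sum_univ_two, Fin.sum_univ_three, hL, Matrix.cons_val_zero,
        Matrix.cons_val_one, Matrix.cons_val, h₁, h₂]
      have : w' = (p' + q') * w' := by rw [h', one_mul]
      nth_rewrite 3 [this]
      module
    rw [e1, e2, norm_smul, Real.norm_eq_abs] at this
    have e3 : ∀ z, (inner ℝ (((p' : ℝ) - q') • y) (G z) : ℝ)
        = ((p' : ℝ) - q') * ‖y‖ * inner ℝ (‖y‖⁻¹ • y) (G z) := fun z => by
      simp only [real_inner_smul_left]; field_simp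
    simp only [e3] at this
    rw [integral_const_mul, integral_pi_sum_smul _ _ (hG.stronglyMeasurable_inner _)
      (hG.abs_inner_le _)] at this
    exact this
  set g : (Fin n → Fin 3) → ℝ := fun σ =>
    ∫ z, inner ℝ (‖y‖⁻¹ • y) (G z) ∂(Measure.pi fun j => L (σ j)) with hg
  have hg1 : ∀ σ, |g σ| ≤ 1 := fun σ => by
    have h : ∀ z, ‖(inner ℝ (‖y‖⁻¹ • y) (G z) : ℝ)‖ ≤ 1 := fun z => by
      refine (hG.abs_inner_le _ z).trans_eq ?_
      rw [norm_smul, norm_inv, norm_norm, inv_mul_cancel₀ hy.ne']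
    have h' := norm_integral_le_of_norm_le_const (μ := Measure.pi fun j => L (σ j))
      (Filter.Eventually.of_forall h)
    simpa using h'
  -- These are the label weights of the unbiased sign. A bias `±δ` tilts them by `(0, ±δ, ∓δ)`, with
  -- χ² distance `δ² w` per answer.
  set c : Fin 3 → ℝ := ![(w' : ℝ), w / 2, w / 2] with hc
  have hc0 : ∀ i, 0 ≤ c i := by
    intro i; fin_cases i <;> simp only [hc] <;> simp <;> positivity
  have hc1 : ∑ i, c i = 1 := by
    simp only [hc, Fin.sum_univ_three, Matrix.cons_val_zero, Matrix.cons_val_one,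
      Matrix.cons_val]
    linarith
  have close : ∀ t : ℝ, t ^ 2 = δ ^ 2 →
      |∑ σ, (∏ j, c (σ j) * (1 + (![0, t, -t] : Fin 3 → ℝ) (σ j))) * g σ
        - ∑ σ, (∏ j, c (σ j)) * g σ| ≤ η := by
    intro t ht
    refine abs_le_of_sq_le_sq ?_ hη
    refine (sq_sum_prod_sub_le (s := δ ^ 2 * w) hc0 hc1 ?_ ?_ hg1).trans (by linarith)
    · simp only [hc, Fin.sum_univ_three, Matrix.cons_val_zero, Matrix.cons_val_one,
        Matrix.cons_val]
      ring
    · simp only [hc, Fin.sum_univ_three, Matrix.cons_val_zero, Matrix.cons_val_one,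
        Matrix.cons_val, neg_sq, ht]
      ring
  have weights : ∀ (p' q' : ℝ≥0), p' + q' = 1 → ∀ i : Fin 3,
      ((![w', p' * w, q' * w] i : ℝ≥0) : ℝ)
        = c i * (1 + (![0, (p' : ℝ) - q', -((p' : ℝ) - q')] : Fin 3 → ℝ) i) := by
    intro p' q' h' i
    have hR : (p' : ℝ) = 1 - q' := by
      rw [eq_sub_iff_add_eq]; exact_mod_cast h'
    fin_cases i <;> simp [hc, hR] <;> ring
  -- Both opposite biases are `η`-close to the same base value, which cancels when the two
  -- guarantees are added.
  have m1 := main p q hpq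
  have m2 := main q p (by rw [add_comm, hpq])
  simp only [weights p q hpq] at m1
  simp only [weights q p (by rw [add_comm, hpq])] at m2
  have c1 := close ((p : ℝ) - q) rfl
  have c2 := close ((q : ℝ) - p) (by rw [hδ]; ring)
  rw [abs_le] at c1 c2
  rw [abs_of_nonneg hδ0] at m1
  rw [abs_sub_comm, abs_of_nonneg hδ0] at m2
  have hpos : 0 ≤ δ * ‖y‖ := by positivity
  have k1 := mul_le_mul_of_nonneg_left c1.1 hpos
  have k2 := mul_le_mul_of_nonneg_left c2.2 hpos
  have hneg : (q : ℝ) - p = -δ := by rw [hδ]; ring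
  simp only [hneg, ← hδ] at m1 m2 k1 k2
  nlinarith

end IsDescentEstimator

end Estimator

/-- The moment generating function of a Rademacher vector. -/
theorem sum_exp_rademacher_le {d : ℕ} (g : Fin d → ℝ) :
    ∑ v : Fin d → Bool, Real.exp (∑ i, (if v i then 1 else -1) * g i)
      ≤ 2 ^ d * Real.exp ((∑ i, g i ^ 2) / 2) := by
  simp only [Real.exp_sum]
  have := Finset.prod_univ_sum (fun _ : Fin d => (Finset.univ : Finset Bool))
    (fun i b => Real.exp ((if b then 1 else -1) * g i))
  rw [Fintype.piFinset_univ] at this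
  rw [← this, Finset.sum_div, Real.exp_sum]
  calc _ = ∏ i, (2 * Real.cosh (g i)) := by
        refine Finset.prod_congr rfl fun i _ => ?_
        simp [Real.cosh_eq]; ring
    _ ≤ ∏ i, (2 * Real.exp (g i ^ 2 / 2)) := by
        refine Finset.prod_le_prod (fun i _ => by positivity) fun i _ => ?_
        gcongr
        exact Real.cosh_le_exp_half_sq _
    _ = _ := by rw [Finset.prod_mul_distrib]; simp

/-! ### Properties of quantizers -/

namespace Quantizer

variable {S X : Type*} [MeasurableSpace S] [MeasurableSpace X] {r : ℕ}

theorem kernel_apply (Q : Quantizer S X r) (μ : Measure S) [SFinite μ] (x : X) :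
    Q.kernel μ x = μ.map fun s => Q.apply s x := rfl

/-- The sum over the codewords of the laws of their decodings. -/
noncomputable def codebook (Q : Quantizer S X r) (μ : Measure S) : Measure X :=
  ∑ b : Fin r → Bool, μ.map fun s => Q.dec s b

theorem measurable_dec_left (Q : Quantizer S X r) (b : Fin r → Bool) :
    Measurable fun s => Q.dec s b :=
  Q.measurable_dec.comp (measurable_id.prodMk measurable_const)

/-- For each seed the output is one of the `2 ^ r` decoded words. This gives a dominating measure
independent of the input, the only form in which the precision enters `erasure`. -/
theorem kernel_le_codebook (Q : Quantizer S X r) (μ : Measure S) [SFinite μ] (x : X) :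
    Q.kernel μ x ≤ Q.codebook μ := by
  refine Measure.le_iff.2 fun A hA => ?_
  rw [kernel_apply, Measure.map_apply (Q.measurable_apply_left x) hA, codebook,
    Measure.coe_finsetSum, Finset.sum_apply]
  simp only [Measure.map_apply (Q.measurable_dec_left _) hA]
  refine le_trans (measure_mono fun s hs => ?_) (measure_biUnion_finset_le _ _)
  exact Set.mem_biUnion (Finset.mem_coe.2 (Finset.mem_univ (Q.enc s x))) hs

theorem codebook_univ (Q : Quantizer S X r) (μ : Measure S) [IsProbabilityMeasure μ] :
    Q.codebook μ Set.univ = 2 ^ r := by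
  simp [codebook, Measure.map_apply (Q.measurable_dec_left _) MeasurableSet.univ]

instance isFiniteMeasure_codebook (Q : Quantizer S X r) (μ : Measure S)
    [IsProbabilityMeasure μ] : IsFiniteMeasure (Q.codebook μ) :=
  ⟨by rw [codebook_univ]; exact ENNReal.pow_lt_top (by simp)⟩

theorem kernel_eq_of_precision_zero (Q : Quantizer S X 0) (μ : Measure S) [SFinite μ] (x y : X) :
    Q.kernel μ x = Q.kernel μ y := by
  simp only [kernel_apply, apply]
  congr 1
  funext s
  rw [Subsingleton.elim (Q.enc s x) (Q.enc s y)]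

end Quantizer

/-- In the innermost bin, a gain-shape quantizer outputs `0` or `m` times the quantized shape. -/
theorem kernel_eq_mixture {S : Type*} [MeasurableSpace S] {μ : Measure S} [IsProbabilityMeasure μ]
    {d r rg rs : ℕ} [NeZero d] {Q : Quantizer S (EuclideanSpace ℝ (Fin d)) r}
    {Qg : Quantizer S ℝ rg} {Qs : Quantizer S (EuclideanSpace ℝ (Fin d)) rs} {m : ℝ}
    (hQ : IsGainShape μ Q Qg Qs) (hind : IndependentGainShape μ Qg Qs) (hg : UniformGain μ Qg m)
    {y : EuclideanSpace ℝ (Fin d)} (hy : ‖y‖ ≤ m) {w w' : ℝ≥0} (hw : w' + w = 1)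
    (hwy : (w : ℝ) = μ.real {s | Qg.apply s ‖y‖ = m}) :
    Q.kernel μ y = w' • Measure.dirac 0 + w • μ.map fun s => m • Qs.apply s (shape y) := by
  have hgm : Measurable fun s => Qg.apply s ‖y‖ := Qg.measurable_apply_left _
  have hsm : Measurable fun s => m • Qs.apply s (shape y) :=
    (Qs.measurable_apply_left _).const_smul m
  set U : Set S := {s | Qg.apply s ‖y‖ = m} with hU
  have hUm : MeasurableSet U := hgm (measurableSet_singleton m)
  have hμU : μ U = w := by
    rw [← ENNReal.ofReal_coe_nnreal, hwy, ofReal_measureReal]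
  have hμU' : μ Uᶜ = w' := by
    rw [prob_compl_eq_one_sub hUm, hμU]
    have : (w' : ℝ≥0∞) + w = 1 := by exact_mod_cast hw
    rw [← this, ENNReal.add_sub_cancel_right ENNReal.coe_ne_top]
  ext A hA
  rw [Quantizer.kernel_apply, Measure.map_apply (Q.measurable_apply_left y) hA,
    ← measure_inter_add_sdiff _ hUm, add_comm]
  simp only [Measure.coe_add, Pi.add_apply, Measure.coe_nnreal_smul_apply]
  congr 1
  -- Off `U` the gain is almost surely `0`, which erases the shape; on `U` independence lets the
  -- shape keep its unconditional law.
  · have : ((fun s => Q.apply s y) ⁻¹' A \ U : Set S) =ᵐ[μ]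
        {s ∈ Uᶜ | (0 : EuclideanSpace ℝ (Fin d)) ∈ A} := by
      filter_upwards [hQ y, hg.support_subset ‖y‖ ⟨norm_nonneg _, hy⟩] with s h1 h2
      refine propext ⟨fun h => ⟨h.2, ?_⟩, fun h => ⟨?_, h.1⟩⟩
      · have h3 : Qg.apply s ‖y‖ = 0 := h2.resolve_right h.2
        have h4 : Q.apply s y ∈ A := h.1
        rwa [h1, h3, zero_smul] at h4
      · have h3 : Qg.apply s ‖y‖ = 0 := h2.resolve_right h.1
        change Q.apply s y ∈ A
        rw [h1, h3, zero_smul]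
        exact h.2
    rw [measure_congr this, Measure.dirac_apply' _ hA, ← hμU']
    by_cases h0 : (0 : EuclideanSpace ℝ (Fin d)) ∈ A
    · simp only [h0, and_true, Set.indicator_of_mem, Pi.one_apply, mul_one]
      rfl
    · simp [h0]
  · have : ((fun s => Q.apply s y) ⁻¹' A ∩ U : Set S) =ᵐ[μ]
        ((fun s => Qg.apply s ‖y‖) ⁻¹' {m} ∩
          (fun s => Qs.apply s (shape y)) ⁻¹' ((m • ·) ⁻¹' A) : Set S) := by
      filter_upwards [hQ y] with s h1
      refine propext ⟨fun h => ⟨h.2, ?_⟩, fun h => ⟨?_, h.1⟩⟩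
      · have h3 : Qg.apply s ‖y‖ = m := h.2
        have h4 : Q.apply s y ∈ A := h.1
        rwa [h1, h3] at h4
      · have h3 : Qg.apply s ‖y‖ = m := h.1
        change Q.apply s y ∈ A
        rw [h1, h3]
        exact h.2
    rw [measure_congr this, (hind y).measure_inter_preimage_eq_mul _ _
      (measurableSet_singleton m) (measurable_const_smul m hA), Measure.map_apply hsm hA, ← hμU]
    rfl

/-! ### Random sign vectors and the dimension bound. -/

section Erasure

variable {d n : ℕ}

/-- The sign vector of `v`, scaled to norm one. -/
noncomputable def signVector (v : Fin d → Bool) : EuclideanSpace ℝ (Fin d) :=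
  WithLp.toLp 2 fun i => (if v i then 1 else -1) / √(d : ℝ)

theorem norm_signVector [NeZero d] (v : Fin d → Bool) : ‖signVector v‖ = 1 := by
  have hd : (0 : ℝ) < d := Nat.cast_pos.2 (NeZero.pos d)
  rw [EuclideanSpace.norm_eq, Real.sqrt_eq_one]
  have : ∀ i, ‖signVector v i‖ ^ 2 = 1 / d := fun i => by
    simp only [signVector, Real.norm_eq_abs, sq_abs, div_pow, Real.sq_sqrt hd.le]
    split_ifs <;> norm_num
  simp only [this, Finset.sum_const, Finset.card_univ, Fintype.card_fin, nsmul_eq_mul]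
  field_simp

theorem sum_exp_inner_signVector_le (g : EuclideanSpace ℝ (Fin d)) (t : ℝ) :
    ∑ v : Fin d → Bool, Real.exp (t * √(d : ℝ) * inner ℝ (signVector v) g)
      ≤ 2 ^ d * Real.exp (t ^ 2 * ‖g‖ ^ 2 / 2) := by
  have h := sum_exp_rademacher_le fun i => t * g i
  have e : ∑ i, (t * g i) ^ 2 = t ^ 2 * ‖g‖ ^ 2 := by
    rw [EuclideanSpace.real_norm_sq_eq, Finset.mul_sum]
    exact Finset.sum_congr rfl fun i _ => by ring
  rw [e] at h
  refine le_trans (le_of_eq (Finset.sum_congr rfl fun v _ => ?_)) h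
  congr 1
  rw [PiLp.inner_apply, Finset.mul_sum]
  refine Finset.sum_congr rfl fun i _ => ?_
  have hd : √(d : ℝ) ≠ 0 := by
    have : (0 : ℝ) < d := Nat.cast_pos.2 (Fin.pos i)
    positivity
  simp only [signVector, RCLike.inner_apply, conj_trivial]
  field_simp

end Erasure

theorem integrable_exp_signVector {d : ℕ} [NeZero d] {Z : Type*} [MeasurableSpace Z]
    (ρ : Measure Z) [IsFiniteMeasure ρ] {g : Z → EuclideanSpace ℝ (Fin d)}
    (hg : StronglyMeasurable g) (hg1 : ∀ z, ‖g z‖ ≤ 1) (t s : ℝ) (v : Fin d → Bool) :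
    Integrable (fun z => Real.exp (t * √(d : ℝ) * inner ℝ (signVector v) (g z) - s)) ρ := by
  have hm : Measurable fun z => (inner ℝ (signVector v) (g z) : ℝ) :=
    ((continuous_const.inner continuous_id).comp_stronglyMeasurable hg).measurable
  refine Integrable.of_bound (C := Real.exp (|t * √(d : ℝ)| - s))
    (Real.measurable_exp.comp ((hm.const_mul _).sub_const _)).aestronglyMeasurable
    (Filter.Eventually.of_forall fun z => ?_)
  rw [Real.norm_of_nonneg (Real.exp_pos _).le, Real.exp_le_exp]
  refine sub_le_sub_right ((le_abs_self _).trans ?_) _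
  rw [abs_mul]
  refine mul_le_of_le_one_right (abs_nonneg _) ((abs_real_inner_le_norm _ _).trans ?_)
  rw [norm_signVector, one_mul]
  exact hg1 z

/-- Rademacher averages against a measure that does not depend on the signs. -/
theorem sum_integral_exp_signVector_le {d : ℕ} [NeZero d] {Z : Type*} [MeasurableSpace Z]
    (ρ : Measure Z) [IsFiniteMeasure ρ] {g : Z → EuclideanSpace ℝ (Fin d)}
    (hg : StronglyMeasurable g) (hg1 : ∀ z, ‖g z‖ ≤ 1) (t s : ℝ) :
    ∑ v : Fin d → Bool, ∫ z, Real.exp (t * √(d : ℝ) * inner ℝ (signVector v) (g z) - s) ∂ρ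
      ≤ 2 ^ d * Real.exp (t ^ 2 / 2 - s) * ρ.real Set.univ := by
  have hi := integrable_exp_signVector ρ hg hg1 t s
  rw [← integral_finsetSum _ fun v _ => hi v]
  refine (integral_mono (integrable_finsetSum _ fun v _ => hi v)
    (integrable_const (2 ^ d * Real.exp (t ^ 2 / 2 - s))) fun z => ?_).trans_eq ?_
  · simp only [Real.exp_sub, ← Finset.sum_div]
    rw [mul_div_assoc']
    gcongr
    refine (sum_exp_inner_signVector_le (g z) t).trans ?_
    gcongr
    exact mul_le_of_le_one_right (sq_nonneg t) (pow_le_one₀ (norm_nonneg _) (hg1 z))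
  · rw [integral_const, smul_eq_mul, mul_comm]

namespace IsDescentEstimator

/-- Rare full revelation of a random sign vector: if every output law of the channel is dominated
by a fixed measure of mass `2 ^ r`, then `r` has to be linear in the dimension. -/
theorem erasure {d n r : ℕ} [NeZero d] {B ε : ℝ}
    {κ : Kernel (EuclideanSpace ℝ (Fin d)) (EuclideanSpace ℝ (Fin d))} [IsMarkovKernel κ]
    {G : (Fin n → EuclideanSpace ℝ (Fin d)) → EuclideanSpace ℝ (Fin d)}
    (hG : IsDescentEstimator κ G B ε) {R : Measure (EuclideanSpace ℝ (Fin d))} [IsFiniteMeasure R]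
    (hR : ∀ y, κ y ≤ R) (hRr : R Set.univ = 2 ^ r) (hr : r ≠ 0) {p q : ℝ≥0} (hpq : p + q = 1)
    {b θ : ℝ} (hθ : 0 ≤ θ) (hb : 0 < b) (hq : 0 < q) (hbB : q * b ^ 2 ≤ B ^ 2)
    (hε : ε ≤ q * b * (1 - θ)) :
    θ / 2 ≤ (1 + q) ^ n * Real.exp (-(θ ^ 2 * d / (8 * r))) := by
  classical
  have hd : (0 : ℝ) < d := Nat.cast_pos.2 (NeZero.pos d)
  have hpqR : (p : ℝ) + q = 1 := by exact_mod_cast hpq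
  have hqR : (0 : ℝ) < q := by exact_mod_cast hq
  -- The label `i` says whether the answer carries the sign vector or is `0`; `L'` dominates `L v`
  -- uniformly in `v`.
  set L : (Fin d → Bool) → Bool → Measure (EuclideanSpace ℝ (Fin d)) := fun v i =>
    if i then κ (b • signVector v) else κ 0 with hL
  have hLp : ∀ v i, IsProbabilityMeasure (L v i) := by
    intro v i; simp only [hL]; split_ifs <;> infer_instance
  set L' : Bool → Measure (EuclideanSpace ℝ (Fin d)) := fun i => if i then R else κ 0 with hL'
  have hLf' : ∀ i, IsFiniteMeasure (L' i) := by
    intro i; simp only [hL']; split_ifs <;> infer_instance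
  have hLL : ∀ v i, L v i ≤ L' i := by
    intro v i; simp only [hL, hL']; split_ifs
    · exact hR _
    · exact le_rfl
  set c : Bool → ℝ≥0 := fun i => if i then q else p with hc
  set F : (Fin d → Bool) → (Fin n → EuclideanSpace ℝ (Fin d)) → ℝ := fun v z =>
    inner ℝ (signVector v) (-G z) with hF
  -- The exponent is `(θ d / 2) (F - θ / 2)`: `H` is a Chernoff majorant of the event `F > θ / 2`,
  -- truncated at `1` in `J`.
  set H : (Fin d → Bool) → (Fin n → EuclideanSpace ℝ (Fin d)) → ℝ := fun v z =>
    Real.exp (θ / 2 * √(d : ℝ) * √(d : ℝ) * F v z - θ ^ 2 * d / 4) with hH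
  have hFabs : ∀ v z, |F v z| ≤ 1 := fun v z => by
    simp only [hF, inner_neg_right, abs_neg]
    exact (hG.abs_inner_le _ z).trans_eq (norm_signVector v)
  have hFm : ∀ v, StronglyMeasurable (F v) := fun v => by
    simp only [hF, inner_neg_right]
    exact (hG.stronglyMeasurable_inner _).neg
  have hHm : ∀ v, StronglyMeasurable (H v) := fun v =>
    (Real.measurable_exp.comp (((hFm v).measurable.const_mul _).sub_const _)).stronglyMeasurable
  set J : (Fin d → Bool) → (Fin n → EuclideanSpace ℝ (Fin d)) → ℝ := fun v z =>
    min 1 (H v z) with hJ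
  have hJm : ∀ v, StronglyMeasurable (J v) := fun v => stronglyMeasurable_const.inf (hHm v)
  have hJ0 : ∀ v z, 0 ≤ J v z := fun v z => le_min zero_le_one (Real.exp_pos _).le
  have hJabs : ∀ v z, |J v z| ≤ 1 := fun v z => by
    rw [abs_of_nonneg (hJ0 v z)]; exact min_le_left _ _
  -- each sign vector is detected
  have lower : ∀ v, θ ≤ ∫ z, F v z ∂(Measure.pi fun _ : Fin n => ∑ i, c i • L v i) := by
    intro v
    have h := hG.le_of_mixture Bool c (fun i => if i then b • signVector v else 0)
      (by simpa [hc, add_comm] using hpq)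
      (by simpa [hc, norm_smul, norm_signVector, abs_of_pos hb] using hbB)
    have e1 : ∑ i, c i • (if i then b • signVector v else 0) = ((q : ℝ) * b) • signVector v := by
      simp [hc, NNReal.smul_def, smul_smul]
    have e2 : ∑ i, c i • κ (if i then b • signVector v else 0) = ∑ i, c i • L v i := by
      simp [hL]
    have e3 : ∀ z, (inner ℝ (((q : ℝ) * b) • signVector v) (G z) : ℝ) = -(q * b) * F v z := by
      intro z; simp only [hF, real_inner_smul_left, inner_neg_right]; ring
    rw [e1, e2, norm_smul, norm_signVector, mul_one, Real.norm_of_nonneg (by positivity)] at h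
    simp only [e3] at h
    rw [integral_const_mul] at h
    have hqb : 0 < (q : ℝ) * b := by positivity
    have : (q : ℝ) * b * θ ≤
        q * b * ∫ z, F v z ∂(Measure.pi fun _ : Fin n => ∑ i, c i • L v i) := by linarith
    exact le_of_mul_le_mul_left this hqb
  have hFJ : ∀ v z, F v z ≤ θ / 2 + J v z := by
    intro v z
    rcases le_or_gt (F v z) (θ / 2) with h | h
    · linarith [hJ0 v z]
    · have h1 : 1 ≤ H v z := by
        refine Real.one_le_exp ?_
        rw [mul_assoc (θ / 2), Real.mul_self_sqrt hd.le]
        have := mul_le_mul_of_nonneg_left h.le (show 0 ≤ θ / 2 * d by positivity)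
        linarith
      have h2 : J v z = 1 := min_eq_left h1
      linarith [(abs_le.1 (hFabs v z)).2]
  have hmix : ∀ v, IsProbabilityMeasure (∑ i, c i • L v i) := fun v => ⟨by
    simp only [Measure.coe_finsetSum, Finset.sum_apply, Measure.coe_nnreal_smul_apply,
      measure_univ, mul_one]
    have : (q : ℝ≥0∞) + p = 1 := by rw [add_comm]; exact_mod_cast hpq
    simpa [hc] using this⟩
  have lower' : ∀ v, θ / 2 ≤ ∑ σ : Fin n → Bool, (∏ j, (c (σ j) : ℝ)) *
      ∫ z, J v z ∂(Measure.pi fun j => L v (σ j)) := by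
    intro v
    rw [← integral_pi_sum_smul _ _ (hJm v) (hJabs v)]
    have hi : Integrable (J v) (Measure.pi fun _ : Fin n => ∑ i, c i • L v i) :=
      Integrable.of_bound (hJm v).aestronglyMeasurable 1 (Filter.Eventually.of_forall (hJabs v))
    have h := integral_mono (μ := Measure.pi fun _ : Fin n => ∑ i, c i • L v i)
      (Integrable.of_bound (hFm v).aestronglyMeasurable 1 (Filter.Eventually.of_forall (hFabs v)))
      ((integrable_const (θ / 2)).add hi) (hFJ v)
    simp only [Pi.add_apply] at h
    rw [integral_add (integrable_const _) hi] at h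
    simp only [integral_const, probReal_univ, one_smul] at h
    linarith [lower v]
  -- the answers where the signs are erased carry no information
  set s : ℝ := Real.exp (-(θ ^ 2 * d / 8)) with hs
  have upper : ∀ σ : Fin n → Bool,
      ∑ v : Fin d → Bool, ∫ z, J v z ∂(Measure.pi fun j => L v (σ j))
        ≤ 2 ^ d * ((∏ j, if σ j then (2 : ℝ) else 1) * s ^ ((r : ℝ)⁻¹)) := by
    intro σ
    set N : ℝ := ∏ j, if σ j then (2 : ℝ) else 1 with hN
    have hN0 : 0 ≤ N := Finset.prod_nonneg fun j _ => by split_ifs <;> norm_num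
    set A : ℝ := ∑ v : Fin d → Bool, ∫ z, J v z ∂(Measure.pi fun j => L v (σ j)) with hA
    have hA0 : 0 ≤ A := Finset.sum_nonneg fun v _ => integral_nonneg (hJ0 v)
    have hA1 : A ≤ 2 ^ d := by
      refine (Finset.sum_le_card_nsmul Finset.univ _ 1 fun v _ => ?_).trans_eq (by simp)
      have h := norm_integral_le_of_norm_le_const (μ := Measure.pi fun j => L v (σ j))
        (Filter.Eventually.of_forall fun z => (Real.norm_eq_abs (J v z)).trans_le (hJabs v z))
      simp only [probReal_univ, mul_one] at h
      exact (Real.le_norm_self _).trans h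
    -- After domination by `L'` the measure is free of `v`, so the Rademacher bound applies; the
    -- price is a mass factor `2 ^ r` per informative answer.
    have hA2 : A ≤ 2 ^ d * (N ^ r * s) := by
      have hi := integrable_exp_signVector (Measure.pi fun j => L' (σ j))
        hG.stronglyMeasurable.neg (fun z => (norm_neg (G z)).trans_le (hG.norm_le_one z))
        (θ / 2 * √(d : ℝ)) (θ ^ 2 * d / 4)
      have hsum := sum_integral_exp_signVector_le (Measure.pi fun j => L' (σ j))
        hG.stronglyMeasurable.neg (fun z => (norm_neg (G z)).trans_le (hG.norm_le_one z))
        (θ / 2 * √(d : ℝ)) (θ ^ 2 * d / 4)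
      have hle : ∀ v, (Measure.pi fun j => L v (σ j)) ≤ Measure.pi fun j => L' (σ j) :=
        fun v => pi_le_pi fun j => hLL v (σ j)
      have hmass : (Measure.pi fun j => L' (σ j)).real Set.univ = N ^ r := by
        rw [measureReal_def, Measure.pi_univ, ENNReal.toReal_prod, hN, ← Finset.prod_pow]
        refine Finset.prod_congr rfl fun j _ => ?_
        simp only [hL']
        split_ifs
        · simp [hRr]
        · simp
      have hexp : Real.exp ((θ / 2 * √(d : ℝ)) ^ 2 / 2 - θ ^ 2 * d / 4) = s := by
        rw [hs, mul_pow, Real.sq_sqrt hd.le]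
        congr 1
        ring
      rw [hmass, hexp] at hsum
      refine (Finset.sum_le_sum fun v _ => ?_).trans (hsum.trans_eq (by ring))
      refine (integral_mono_of_nonneg (Filter.Eventually.of_forall (hJ0 v))
        ((hi v).mono_measure (hle v)) (Filter.Eventually.of_forall fun z => ?_)).trans
        (integral_mono_measure (hle v) (Filter.Eventually.of_forall fun z => (Real.exp_pos _).le)
          (hi v))
      exact min_le_right _ _
    have h2 : (0 : ℝ) < 2 ^ d := by positivity
    have hx0 : 0 ≤ A / 2 ^ d := by positivity
    have hx1 : A / 2 ^ d ≤ 1 := (div_le_one h2).2 hA1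
    have hx2 : A / 2 ^ d ≤ N ^ r * s := by rwa [div_le_iff₀' h2]
    have hs0 : 0 ≤ s := (Real.exp_pos _).le
    have hr1 : (r : ℝ)⁻¹ ≤ 1 := inv_le_one_of_one_le₀ (by exact_mod_cast Nat.one_le_iff_ne_zero.2 hr)
    rw [← div_le_iff₀' h2]
    -- Averaging `N ^ r` over the labels would cost a factor exponential in `2 ^ r`. Since `A / 2 ^
    -- d ≤ 1`, taking an `r`-th root is allowed and leaves `N`, whose mean is only `(1 + q) ^ n`.
    calc A / 2 ^ d = (A / 2 ^ d) ^ (1 : ℝ) := (Real.rpow_one _).symm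
      _ ≤ (A / 2 ^ d) ^ ((r : ℝ)⁻¹) := by
          rcases hx0.eq_or_lt with h | h
          · rw [← h, Real.rpow_one]; exact Real.rpow_nonneg le_rfl _
          · exact Real.rpow_le_rpow_of_exponent_ge h hx1 hr1
      _ ≤ (N ^ r * s) ^ ((r : ℝ)⁻¹) := Real.rpow_le_rpow hx0 hx2 (by positivity)
      _ = N * s ^ ((r : ℝ)⁻¹) := by
          rw [Real.mul_rpow (by positivity) hs0, Real.pow_rpow_inv_natCast hN0 hr]
  have total : 2 ^ d * (θ / 2) ≤ 2 ^ d * ((1 + q) ^ n * s ^ ((r : ℝ)⁻¹)) := by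
    calc (2 : ℝ) ^ d * (θ / 2) = ∑ v : Fin d → Bool, θ / 2 := by simp
      _ ≤ ∑ v : Fin d → Bool, ∑ σ : Fin n → Bool, (∏ j, (c (σ j) : ℝ)) *
            ∫ z, J v z ∂(Measure.pi fun j => L v (σ j)) := Finset.sum_le_sum fun v _ => lower' v
      _ = ∑ σ : Fin n → Bool, (∏ j, (c (σ j) : ℝ)) *
            ∑ v : Fin d → Bool, ∫ z, J v z ∂(Measure.pi fun j => L v (σ j)) := by
          rw [Finset.sum_comm]; simp only [Finset.mul_sum]
      _ ≤ ∑ σ : Fin n → Bool, (∏ j, (c (σ j) : ℝ)) *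
            (2 ^ d * ((∏ j, if σ j then (2 : ℝ) else 1) * s ^ ((r : ℝ)⁻¹))) :=
          Finset.sum_le_sum fun σ _ => mul_le_mul_of_nonneg_left (upper σ)
            (Finset.prod_nonneg fun j _ => NNReal.coe_nonneg _)
      _ = (∑ σ : Fin n → Bool, ∏ j, ((c (σ j) : ℝ) * if σ j then (2 : ℝ) else 1)) *
            (2 ^ d * s ^ ((r : ℝ)⁻¹)) := by
          rw [Finset.sum_mul]
          refine Finset.sum_congr rfl fun σ _ => ?_
          rw [Finset.prod_mul_distrib]; ring
      _ = 2 ^ d * ((1 + q) ^ n * s ^ ((r : ℝ)⁻¹)) := by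
          rw [sum_pi_prod fun i : Bool => (c i : ℝ) * if i then (2 : ℝ) else 1]
          have : ∑ i : Bool, (c i : ℝ) * (if i then (2 : ℝ) else 1) = 1 + q := by
            simp [hc]; linarith
          rw [this]; ring
  have := le_of_mul_le_mul_left total (by positivity)
  rw [hs, ← Real.exp_mul] at this
  refine this.trans_eq ?_
  congr 2
  field_simp

end IsDescentEstimator

/-! ### Rare large answers and masking. -/

namespace IsDescentEstimator

variable {E : Type*} [NormedAddCommGroup E] [InnerProductSpace ℝ E] [MeasurableSpace E]
variable {κ : Kernel E E} {n : ℕ} {G : (Fin n → E) → E} {B ε : ℝ}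

/-- Rare answers `±y` that the channel does not distinguish. -/
theorem sq_div_norm_le (hG : IsDescentEstimator κ G B ε) (hB : 0 < B) {y : E} (hy : B ≤ ‖y‖)
    (h : κ (-y) = κ y) : B ^ 2 / ‖y‖ ≤ ε := by
  have hy0 : 0 < ‖y‖ := hB.trans_le hy
  have hq1 : B ^ 2 / ‖y‖ ^ 2 ≤ 1 := (div_le_one (by positivity)).2 (by gcongr)
  -- Sending `y` with this probability, and `0` otherwise, uses exactly the second moment `B²`.
  obtain ⟨q, hq⟩ : ∃ q : ℝ≥0, (q : ℝ) = B ^ 2 / ‖y‖ ^ 2 := ⟨⟨_, by positivity⟩, rfl⟩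
  obtain ⟨p, hp⟩ : ∃ p : ℝ≥0, q + p = 1 :=
    exists_add_of_le (show q ≤ 1 by rw [← NNReal.coe_le_coe, hq]; exact hq1) |>.imp
      fun _ h => h.symm
  have key := hG.norm_le_of_indistinguishable ![q, p] ![y, 0] (by simpa using hp)
    (by simp [hq, hy0.ne']) (by simp [h])
  have e : ‖∑ i, ![q, p] i • ![y, 0] i‖ = B ^ 2 / ‖y‖ := by
    simp only [Fin.sum_univ_two, Matrix.cons_val_zero, Matrix.cons_val_one, smul_zero, add_zero,
      NNReal.smul_def, norm_smul, hq, Real.norm_of_nonneg (show 0 ≤ B ^ 2 / ‖y‖ ^ 2 by positivity)]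
    field_simp
  rwa [e] at key

/-- Answers of norm `C B` in one direction are masked by answers of norm `B` in the opposite
direction, if the latter are revealed with probability at least `2 / C`. -/
theorem masking (hG : IsDescentEstimator κ G B ε) (hB : 0 < B) {u : E} (hu : ‖u‖ = 1)
    {C w₁ w₁' w₂ w₂' : ℝ≥0} (hC : 1 ≤ C) (h₂ : w₂' + w₂ = 1)
    (hw : 2 ≤ C * w₁) {P₀ P₁ P₂ : Measure E}
    (k₁ : κ (B • u) = w₁' • P₀ + w₁ • P₁) (k₁' : κ (-(B • u)) = w₁' • P₀ + w₁ • P₂)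
    (k₂ : κ ((C * B) • u) = w₂' • P₀ + w₂ • P₁)
    (k₂' : κ (-((C * B) • u)) = w₂' • P₀ + w₂ • P₂) : B / (4 * C) ≤ ε := by
  have hC0 : 0 < C := zero_lt_one.trans_le hC
  have hw1 : 0 < w₁ := by
    rcases eq_or_ne w₁ 0 with h | h
    · simp [h] at hw
    · exact pos_iff_ne_zero.2 h
  have hw2 : w₂ ≤ 1 := h₂ ▸ le_add_self
  -- Chosen so that `-(B • u)` with weight `q α` reveals `P₂` exactly as often as `(C * B) • u` with
  -- weight `q` reveals `P₁`; the image is then symmetric.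
  set α : ℝ≥0 := w₂ / w₁ with hα
  have hαw : α * w₁ = w₂ := div_mul_cancel₀ _ hw1.ne'
  have hα2 : 2 * α ≤ C := by
    rw [hα, mul_div_assoc', div_le_iff₀ hw1]
    calc 2 * w₂ ≤ 2 * 1 := by gcongr
      _ ≤ C * w₁ := by simpa using hw
  -- The large answers use half of the second moment budget and the masking answers at most a
  -- quarter.
  set q : ℝ≥0 := 1 / (2 * C ^ 2) with hq
  have hqC : 2 * (q * C ^ 2) = 1 := by
    rw [hq]; field_simp
  have hqCR : 2 * ((q : ℝ) * C ^ 2) = 1 := by exact_mod_cast hqC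
  have hα2R : 2 * (α : ℝ) ≤ C := by exact_mod_cast hα2
  have hCR : (1 : ℝ) ≤ C := by exact_mod_cast hC
  have hq0 : (0 : ℝ) ≤ q := q.2
  have hα0 : (0 : ℝ) ≤ α := α.2
  have b1 : (q : ℝ) ≤ q * C ^ 2 := le_mul_of_one_le_right hq0 (one_le_pow₀ hCR)
  have b2 : (q : ℝ) * α ≤ q * C ^ 2 / 2 := by
    have : (α : ℝ) ≤ C ^ 2 / 2 := by nlinarith
    calc (q : ℝ) * α ≤ q * (C ^ 2 / 2) := by gcongr
      _ = _ := by ring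
  obtain ⟨p, hp⟩ : ∃ p : ℝ≥0, 1 = q + q * α + p :=
    exists_add_of_le (show q + q * α ≤ 1 by
      rw [← NNReal.coe_le_coe]; push_cast; linarith)
  have key := hG.norm_le_of_indistinguishable ![q, q * α, p] ![(C * B) • u, -(B • u), 0]
    (by simpa [Fin.sum_univ_three] using hp.symm) ?_ ?_
  · have e : ∑ i, ![q, q * α, p] i • ![((C : ℝ) * B) • u, -(B • u), 0] i
        = (q * (C - α) * B : ℝ) • u := by
      simp only [Fin.sum_univ_three, Matrix.cons_val_zero, Matrix.cons_val_one, Matrix.cons_val,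
        NNReal.smul_def, NNReal.coe_mul]
      module
    rw [e, norm_smul, hu, mul_one] at key
    refine le_trans ?_ ((Real.le_norm_self _).trans key)
    have : B / (4 * C) = q * (C / 2) * B := by
      have : (C : ℝ) ≠ 0 := by positivity
      rw [hq]; push_cast; field_simp; norm_num
    rw [this]
    gcongr
    linarith
  · simp only [Fin.sum_univ_three, Matrix.cons_val_zero, Matrix.cons_val_one, Matrix.cons_val,
      norm_smul, norm_neg, hu, norm_zero, mul_one, Real.norm_eq_abs, sq_abs, NNReal.coe_mul,
      mul_pow]
    nlinarith [sq_nonneg B]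
  · simp only [Fin.sum_univ_three, Matrix.cons_val_zero, Matrix.cons_val_one, Matrix.cons_val,
      neg_neg, neg_zero, k₁, k₁', k₂, k₂', ← hαw]
    module

end IsDescentEstimator

/-! ### Consequences for the rate `6 B / √T`. -/

theorem sq_sqrt_natCast (T : ℕ) : √(T : ℝ) ^ 2 = T := Real.sq_sqrt (Nat.cast_nonneg T)

/-- If answers of norm `B` and `2000 B` in the directions `±u` are either erased or replaced by a
noisy sign that does not depend on the norm, then the error rate `6 B / √T` is impossible. -/
theorem false_of_innermost_level {E : Type*} [NormedAddCommGroup E] [InnerProductSpace ℝ E]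
    [MeasurableSpace E] {κ : Kernel E E} {n T : ℕ} {G : (Fin n → E) → E} {B : ℝ} (hB : 0 < B)
    (hG : IsDescentEstimator κ G B (6 * B / √(T : ℝ))) (hn : n ≤ T) (hT : 48000 < √(T : ℝ))
    {u : E} (hu : ‖u‖ = 1) {w₁ w₁' w₂ w₂' : ℝ≥0} (h₁ : w₁' + w₁ = 1) (h₂ : w₂' + w₂ = 1)
    {P₀ P₁ P₂ : Measure E}
    [IsProbabilityMeasure P₀] [IsProbabilityMeasure P₁] [IsProbabilityMeasure P₂]
    (k₁ : κ (B • u) = w₁' • P₀ + w₁ • P₁) (k₁' : κ (-(B • u)) = w₁' • P₀ + w₁ • P₂)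
    (k₂ : κ ((2000 * B) • u) = w₂' • P₀ + w₂ • P₁)
    (k₂' : κ (-((2000 * B) • u)) = w₂' • P₀ + w₂ • P₂) : False := by
  have hT0 : 0 < √(T : ℝ) := by linarith
  have hTT : (0 : ℝ) < T := Real.sqrt_pos.1 hT0
  -- With `C = 2000` masking forces `√T ≤ 6 · 8000 = 48000`.
  rcases le_total 2 (2000 * w₁) with h | h
  · have := hG.masking hB hu (C := 2000) (by norm_num) h₂ h k₁ k₁' (by simpa using k₂)
      (by simpa using k₂')
    rw [le_div_iff₀ hT0] at this
    push_cast at this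
    nlinarith
  · have hwR : (2000 : ℝ) * w₁ ≤ 2 := by exact_mod_cast h
    have hy : ‖B • u‖ = B := by rw [norm_smul, hu, mul_one, Real.norm_of_nonneg hB.le]
    -- With `η = 1/2` the error is at least `6.5 B / √T`. The total χ² exponent is at most `169 /
    -- 1000 ≤ 1/5`, and `exp (1/5) ≤ 5/4`.
    set δ : ℝ := 13 / √(T : ℝ) with hδ
    have hδ0 : 0 < δ := by positivity
    have hδ1 : δ ≤ 1 := (div_le_one hT0).2 (by linarith)
    have hδT : δ ^ 2 * T = 169 := by
      rw [hδ, div_pow, sq_sqrt_natCast]; field_simp; norm_num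
    obtain ⟨p, hp⟩ : ∃ p : ℝ≥0, (p : ℝ) = (1 + δ) / 2 := ⟨⟨_, by positivity⟩, rfl⟩
    obtain ⟨q, hq⟩ : ∃ q : ℝ≥0, (q : ℝ) = (1 - δ) / 2 := ⟨⟨_, by linarith⟩, rfl⟩
    have hpq : (p : ℝ) - q = δ := by rw [hp, hq]; ring
    have key := hG.two_point (y := B • u) (by rw [hy]; exact hB) hy.le h₁ (p := p) (q := q)
      (by rw [← NNReal.coe_inj]; push_cast; rw [hp, hq]; ring)
      (by rw [← NNReal.coe_le_coe, hp, hq]; linarith) k₁ k₁' (η := 1 / 2) (by norm_num) (by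
        rw [hpq]
        have hw0 : (0 : ℝ) ≤ w₁ := w₁.2
        calc (1 + δ ^ 2 * w₁) ^ n ≤ Real.exp (δ ^ 2 * w₁) ^ n := by
              gcongr; rw [add_comm]; exact Real.add_one_le_exp _
          _ = Real.exp (n * (δ ^ 2 * w₁)) := (Real.exp_nat_mul _ _).symm
          _ ≤ Real.exp (1 / 5) := by
              refine Real.exp_le_exp.2 ?_
              calc (n : ℝ) * (δ ^ 2 * (w₁ : ℝ)) ≤ T * (δ ^ 2 * (w₁ : ℝ)) := by gcongr
                _ = 169 * (w₁ : ℝ) := by rw [← hδT]; ring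
                _ ≤ 1 / 5 := by linarith
          _ ≤ 1 + (1 / 2) ^ 2 := by
              rw [← Real.le_log_iff_exp_le (by norm_num)]
              have := Real.one_sub_inv_le_log_of_pos (show (0 : ℝ) < 1 + (1 / 2) ^ 2 by norm_num)
              norm_num at this ⊢
              exact this)
    rw [hpq, hy, hδ, le_div_iff₀ hT0] at key
    field_simp at key
    linarith

/-- The precision is at least linear in the dimension. -/
theorem dimension_le {d n r T : ℕ} [NeZero d] {B : ℝ} (hB : 0 < B) (hT : 36 < T) (hn : n ≤ T)
    {κ : Kernel (EuclideanSpace ℝ (Fin d)) (EuclideanSpace ℝ (Fin d))} [IsMarkovKernel κ]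
    {G : (Fin n → EuclideanSpace ℝ (Fin d)) → EuclideanSpace ℝ (Fin d)}
    (hG : IsDescentEstimator κ G B (6 * B / √(T : ℝ)))
    {R : Measure (EuclideanSpace ℝ (Fin d))} [IsFiniteMeasure R]
    (hR : ∀ y, κ y ≤ R) (hRr : R Set.univ = 2 ^ r) (hr : r ≠ 0) : (d : ℝ) ≤ 3440000 * r := by
  have hTT : (37 : ℝ) ≤ T := by exact_mod_cast hT
  have hT0 : 0 < √(T : ℝ) := Real.sqrt_pos.2 (by linarith)
  have h37 : 0 < √(37 : ℝ) := Real.sqrt_pos.2 (by norm_num)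
  have h37' : (6.08 : ℝ) ≤ √37 := Real.le_sqrt_of_sq_le (by norm_num)
  have h37s : √(37 : ℝ) ^ 2 = 37 := Real.sq_sqrt (by norm_num)
  have hr0 : (0 : ℝ) < r := by exact_mod_cast Nat.pos_of_ne_zero hr
  -- `T > 36` makes `q ≤ 1`. The mean has norm `√37 B / √T`, and `√37 · 0.99 > 6` leaves room for `θ
  -- = 1/100`.
  obtain ⟨q, hq⟩ : ∃ q : ℝ≥0, (q : ℝ) = 37 / T := ⟨⟨_, by positivity⟩, rfl⟩
  have hq1 : q ≤ 1 := by
    rw [← NNReal.coe_le_coe, hq]; exact (div_le_one (by linarith)).2 hTT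
  obtain ⟨p, hp⟩ := exists_add_of_le hq1
  have hq0 : 0 < q := by
    rw [← NNReal.coe_pos, hq]; exact div_pos (by norm_num) (by linarith)
  have key := hG.erasure hR hRr hr (p := p) (q := q) (by rw [add_comm, hp])
    (b := B * √(T : ℝ) / √37) (θ := 1 / 100) (by norm_num) (by positivity) hq0
    (by
      rw [hq, div_pow, mul_pow, sq_sqrt_natCast, h37s]
      refine le_of_eq ?_
      field_simp)
    (by
      have e : (q : ℝ) * (B * √(T : ℝ) / √37) * (1 - 1 / 100)
          = √37 * (99 / 100) * B / √(T : ℝ) := by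
        rw [hq, ← sq_sqrt_natCast T, ← h37s]
        field_simp
        norm_num
        ring
      rw [e]
      gcongr
      linarith)
  have hexp : (1 + (q : ℝ)) ^ n ≤ Real.exp 37 := by
    calc (1 + (q : ℝ)) ^ n ≤ Real.exp q ^ n := by
          gcongr; rw [add_comm]; exact Real.add_one_le_exp _
      _ = Real.exp (n * q) := (Real.exp_nat_mul _ _).symm
      _ ≤ Real.exp (T * q) := by gcongr
      _ = Real.exp 37 := by rw [hq]; field_simp
  by_contra! hd
  have h6 : Real.exp (-6) < 1 / 200 := by
    rw [Real.exp_neg, one_div]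
    refine inv_strictAnti₀ (by norm_num) ?_
    calc (200 : ℝ) < 2.7 ^ 6 := by norm_num
      _ ≤ Real.exp 1 ^ 6 := by gcongr; linarith [Real.exp_one_gt_d9]
      _ = Real.exp 6 := by rw [← Real.exp_nat_mul]; norm_num
  -- `3440000 = 43 · 8 · 100²`, where `43 = 37 + 6` beats `exp 37` and leaves `exp (-6) < θ / 2`.
  have hd' : 43 ≤ (1 / 100 : ℝ) ^ 2 * d / (8 * r) := by
    rw [le_div_iff₀ (by positivity)]; linarith
  have : (1 + (q : ℝ)) ^ n * Real.exp (-((1 / 100) ^ 2 * d / (8 * r))) ≤ Real.exp (-6) := by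
    calc _ ≤ Real.exp 37 * Real.exp (-43) := by gcongr
      _ = Real.exp (-6) := by rw [← Real.exp_add]; norm_num
  linarith

theorem shape_smul_of_norm_eq_one {d : ℕ} [NeZero d] {u : EuclideanSpace ℝ (Fin d)}
    (hu : ‖u‖ = 1) {t : ℝ} (ht : 0 < t) : shape (t • u) = u := by
  have hu0 : u ≠ 0 := norm_ne_zero_iff.1 (by rw [hu]; exact one_ne_zero)
  rw [shape, if_neg (smul_ne_zero ht.ne' hu0), norm_smul, hu, mul_one,
    Real.norm_of_nonneg ht.le, smul_smul, inv_mul_cancel₀ ht.ne', one_smul]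

/-- The precision is at least logarithmic in the number of iterations. -/
theorem le_two_pow_of_gain_levels {T r : ℕ} (hr : r ≠ 0) {B M m : ℝ} (hB : 0 < B)
    (hm : M / 2 ^ r ≤ m) (hM : B * √(T : ℝ) / 6 ≤ M) (h : √(T : ℝ) ≤ 48000 ∨ m < 2000 * B) :
    (T : ℝ) ≤ 2 ^ (32 * r) := by
  have hr1 : 1 ≤ r := Nat.one_le_iff_ne_zero.2 hr
  have h0 : 0 ≤ √(T : ℝ) := Real.sqrt_nonneg _
  have h16 : √(T : ℝ) ≤ 2 ^ (16 * r) := by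
    rcases h with h | h
    · calc √(T : ℝ) ≤ 2 ^ 16 := by linarith
        _ ≤ 2 ^ (16 * r) := pow_le_pow_right₀ one_le_two (by omega)
    · have h1 : M ≤ m * 2 ^ r := (div_le_iff₀ (by positivity)).1 hm
      have h2 : m * 2 ^ r ≤ 2000 * B * 2 ^ r := by gcongr
      have h3 : B * √(T : ℝ) ≤ B * (12000 * 2 ^ r) := by linarith
      calc √(T : ℝ) ≤ 12000 * 2 ^ r := le_of_mul_le_mul_left h3 hB
        _ ≤ 2 ^ 14 * 2 ^ r := by gcongr; norm_num
        _ = 2 ^ (14 + r) := (pow_add _ _ _).symm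
        _ ≤ 2 ^ (16 * r) := pow_le_pow_right₀ one_le_two (by omega)
  calc (T : ℝ) = √(T : ℝ) ^ 2 := (sq_sqrt_natCast T).symm
    _ ≤ (2 ^ (16 * r)) ^ 2 := by gcongr
    _ = 2 ^ (32 * r) := by rw [← pow_mul]; congr 1; ring

theorem theoremt :
    ∃ c : ℝ, 0 < c ∧
      ∀ (d r rg rs T n : ℕ) [NeZero d] (B D M m : ℝ), 0 < B → 0 < D → 0 < M →
      36 < T → n ≤ T →
      -- the quantizer, with random seed of law `μ`
      ∀ (S : Type*) [MeasurableSpace S] (μ : Measure S) [IsProbabilityMeasure μ]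
        (Q : Quantizer S (EuclideanSpace ℝ (Fin d)) r)
        (Qg : Quantizer S ℝ rg) (Qs : Quantizer S (EuclideanSpace ℝ (Fin d)) rs),
      IsGainShape μ Q Qg Qs →
      IndependentGainShape μ Qg Qs →
      BoundedDynamicRange μ Q M →
      m ∈ Set.Icc (M / 2 ^ r) M → UniformGain μ Qg m →
      -- the optimization protocol, with internal randomness of law `ν`
      ∀ (W : Type*) [MeasurableSpace W] (ν : Measure W) [IsProbabilityMeasure ν]
        (π : Protocol W (Metric.closedBall (0 : EuclideanSpace ℝ (Fin d)) (D / 2)) n),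
      (∀ (f : EuclideanSpace ℝ (Fin d) → ℝ)
          (O : Kernel (EuclideanSpace ℝ (Fin d)) (EuclideanSpace ℝ (Fin d))) [IsMarkovKernel O],
        IsMeanSquareBoundedOracle (Metric.closedBall 0 (D / 2)) B f O →
        π.error ν (Q.kernel μ ∘ₖ O) f ≤ 3 * D * B / √(T : ℝ)) →
      c * (d + Real.logb 2 T) ≤ (r : ℝ) := by
  -- The two bounds add up to `d + log T ≤ (3440000 + 32) r`.
  refine ⟨1 / 4000000, by norm_num, ?_⟩
  intro d r rg rs T n _ B D M m hB hD hM hT hn S _ μ _ Q Qg Qs hQ hind hdyn hm hgain W _ ν _ π hπ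
  have hTT : (37 : ℝ) ≤ T := by exact_mod_cast hT
  have hT6 : 6 < √(T : ℝ) := by
    rw [Real.lt_sqrt (by norm_num)]; linarith
  have hT0 : 0 < √(T : ℝ) := by linarith
  obtain ⟨G, hG⟩ := exists_estimator (B := B) (ε := 6 * B / √(T : ℝ)) hD
    (Q.kernel μ) ν π (fun f O _ hO => (hπ f O hO).trans_eq (by ring))
  set u : EuclideanSpace ℝ (Fin d) := EuclideanSpace.single 0 1 with hu_def
  have hu : ‖u‖ = 1 := by simp [hu_def]
  have hnorm : ∀ t : ℝ, 0 ≤ t → ‖t • u‖ = t := fun t ht => by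
    rw [norm_smul, hu, mul_one, Real.norm_of_nonneg ht]
  have hr : r ≠ 0 := by
    rintro rfl
    have h := hG.sq_div_norm_le hB (hnorm B hB.le).ge (Q.kernel_eq_of_precision_zero μ _ _)
    rw [hnorm B hB.le, le_div_iff₀ hT0, sq, mul_div_assoc, div_self hB.ne', mul_one] at h
    nlinarith
  have hMB : B * √(T : ℝ) / 6 ≤ M := by
    by_contra! h
    -- `b > M` makes `±b u` indistinguishable, `b > B` makes `B² / b²` a probability, and `b < B √T
    -- / 6` makes the mean `B² / b` exceed the allowed error.
    obtain ⟨b, hb1, hb2⟩ := exists_between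
      (max_lt h (show B < B * √(T : ℝ) / 6 by nlinarith))
    have hMb : M < b := (le_max_left _ _).trans_lt hb1
    have hBb : B < b := (le_max_right _ _).trans_lt hb1
    have hb0 : 0 < b := hB.trans hBb
    obtain ⟨P, hP⟩ := hdyn
    have key := hG.sq_div_norm_le hB (y := b • u) (by rw [hnorm b hb0.le]; exact hBb.le)
      (by rw [hP _ (by rwa [norm_neg, hnorm b hb0.le]), hP _ (by rwa [hnorm b hb0.le])])
    rw [hnorm b hb0.le, div_le_div_iff₀ hb0 hT0] at key
    have : B * (B * √(T : ℝ)) ≤ B * (6 * b) := by linarith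
    have := le_of_mul_le_mul_left this hB
    linarith
  have hlevel : √(T : ℝ) ≤ 48000 ∨ m < 2000 * B := by
    by_contra! h
    obtain ⟨h48, hmB⟩ := h
    -- The weight depends on `t` only, so it is shared by `±t u`; the shape laws depend on the sign
    -- only.
    have hmass : ∀ t : ℝ, 0 < t → t ≤ m → ∃ w' w : ℝ≥0, w' + w = 1 ∧
        Q.kernel μ (t • u) = w' • Measure.dirac 0 + w • μ.map (fun s => m • Qs.apply s u) ∧
        Q.kernel μ (-(t • u)) = w' • Measure.dirac 0 + w • μ.map fun s => m • Qs.apply s (-u) := by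
      intro t ht htm
      obtain ⟨w, hw⟩ : ∃ w : ℝ≥0, (w : ℝ) = μ.real {s | Qg.apply s t = m} :=
        ⟨⟨_, measureReal_nonneg⟩, rfl⟩
      obtain ⟨w', hw'⟩ := exists_add_of_le
        (show w ≤ 1 by rw [← NNReal.coe_le_coe, hw]; exact measureReal_le_one)
      have hww : w' + w = 1 := by rw [add_comm, hw']
      refine ⟨w', w, hww, ?_, ?_⟩
      · have := kernel_eq_mixture hQ hind hgain (y := t • u) (by rwa [hnorm t ht.le]) hww
          (by rwa [hnorm t ht.le])
        rwa [shape_smul_of_norm_eq_one hu ht] at this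
      · have := kernel_eq_mixture hQ hind hgain (y := -(t • u))
          (by rwa [norm_neg, hnorm t ht.le]) hww (by rwa [norm_neg, hnorm t ht.le])
        rwa [← smul_neg, shape_smul_of_norm_eq_one (by rwa [norm_neg]) ht, smul_neg] at this
    obtain ⟨w₁', w₁, h₁, k₁, k₁'⟩ := hmass B hB (by linarith)
    obtain ⟨w₂', w₂, h₂, k₂, k₂'⟩ := hmass (2000 * B) (by linarith) hmB
    have hp : ∀ x, IsProbabilityMeasure (μ.map fun s => m • Qs.apply s x) := fun x =>
      Measure.isProbabilityMeasure_map ((Qs.measurable_apply_left x).const_smul m).aemeasurable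
    have := hp u
    have := hp (-u)
    exact false_of_innermost_level hB hG hn h48 hu h₁ h₂ k₁ k₁' k₂ k₂'
  have hlog : Real.logb 2 T ≤ 32 * r := by
    have h := le_two_pow_of_gain_levels hr hB hm.1 hMB hlevel
    rw [Real.logb_le_iff_le_rpow one_lt_two (by linarith)]
    exact_mod_cast h
  have hdim := dimension_le hB hT hn hG (Q.kernel_le_codebook μ) (Q.codebook_univ μ) hr
  have hr0 : (0 : ℝ) ≤ r := Nat.cast_nonneg r
  linarith
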